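/- Let $K=\mathbb{F}_q$ be a finite field with $q$ elements, and let $\mathcal{C}$ be a clutter with finite vertex set $\{y_1,\ldots,y_n\}$ and with $s\geq 1$ edges $f_1,\ldots,f_s$; that is, $f_1,\ldots,f_s$ are distinct subsets of $\{y_1,\ldots,y_n\}$, none of which is contained in another. Let $v_i=(v_{i1},\ldots,v_{in})\in\{0,1\}^n$ be the characteristic vector of $f_i$ (so $v_{ij}=1$ if and only if $y_j\in f_i$), and let $$X=\{[(x_1^{v_{11}}\cdots x_n^{v_{1n}},\ldots,x_1^{v_{s1}}\cdots x_n^{v_{sn}})]\in\mathbb{P}^{s-1}\ \vert\ x_j\in K\setminus\{0\}\mbox{ for all }j\},$$ where $\mathbb{P}^{s-1}$ is the projective space of dimension $s-1$ over $K$. Let $I(X)$ be the vanishing ideal of $X$, i.e. the ideal of $S=K[t_1,\ldots,t_s]$ generated by the homogeneous polynomials that vanish at all points of $X$; it is called a complete intersection if it can be generated by $s-1$ homogeneous polynomials of $S$. Let $\mathbb{T}=\{[(x_1,\ldots,x_s)]\in\mathbb{P}^{s-1}\ \vert\ x_i\in K\setminus\{0\}\mbox{ for all }i\}$ be the projective torus.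 Then the following are equivalent: (c1) $I(X)$ is a complete intersection. (c2) $I(X)=(t_1^{q-1}-t_s^{q-1},\ldots,t_{s-1}^{q-1}-t_s^{q-1})$. (c3) $X=\mathbb{T}$. -/

import Mathlib

open scoped LinearAlgebra.Projectivization

/-- A clutter on the vertex set `V`: a finite family of subsets of `V` (the edges), none of which is
contained in another one. -/
structure Clutter (V : Type*) where
  edges : Finset (Finset V)
  antichain : IsAntichain (· ⊆ ·) (edges : Set (Finset V))

/-- The characteristic vector of a set `f` of vertices. -/
def characteristicVector {V : Type*} [DecidableEq V] (f : Finset V) : V → ℕ :=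
  fun y => if y ∈ f then 1 else 0

/-- The algebraic toric set in `ℙ^{s-1}` parameterized by the monomials `y^{v_1}, …, y^{v_s}`:
the points `[(x^{v_1}, …, x^{v_s})]` where all `x_j` are non-zero elements of `K`.
(The condition `hw` is automatic for `s ≥ 1`; it is there for forming the projective point.) -/
def algebraicToricSet (K : Type*) [Field K] {V : Type*} [Fintype V] {s : ℕ}
    (v : Fin s → V → ℕ) : Set (ℙ K (Fin s → K)) :=
  {P | ∃ x : V → K, (∀ j, x j ≠ 0) ∧
    ∃ hw : (fun i => ∏ j, x j ^ v i j) ≠ (0 : Fin s → K),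
      P = Projectivization.mk K (fun i => ∏ j, x j ^ v i j) hw}

/-- The projective torus in `ℙ^{s-1}`: the points all of whose coordinates are non-zero. -/
def projectiveTorus (K : Type*) [Field K] (s : ℕ) : Set (ℙ K (Fin s → K)) :=
  {P | ∃ x : Fin s → K, (∀ i, x i ≠ 0) ∧
    ∃ hx : x ≠ 0, P = Projectivization.mk K x hx}

/-- The vanishing ideal `I(X)` of a set `X` of points of `ℙ^{s-1}`: the ideal of `K[t_1, …, t_s]`
generated by the homogeneous polynomials that vanish at (every representative of) every point
of `X`. -/
noncomputable def projVanishingIdeal {K : Type*} [Field K] {s : ℕ} (X : Set (ℙ K (Fin s → K))) :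
    Ideal (MvPolynomial (Fin s) K) :=
  Ideal.span {f | (∃ d : ℕ, f.IsHomogeneous d) ∧
    ∀ (w : Fin s → K) (hw : w ≠ 0), Projectivization.mk K w hw ∈ X → MvPolynomial.eval w f = 0}

/-- The ideal `I` of `K[t_1, …, t_s]` can be generated by `s - 1` homogeneous polynomials.
For the vanishing ideal of a non-empty finite set of points of `ℙ^{s-1}` (which has
height `s - 1`) this is the definition of a complete intersection. -/
def IsCompleteIntersection {K : Type*} [Field K] {s : ℕ}
    (I : Ideal (MvPolynomial (Fin s) K)) : Prop :=
  ∃ g : Fin (s - 1) → MvPolynomial (Fin s) K,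
    (∀ k, ∃ d : ℕ, (g k).IsHomogeneous d) ∧ I = Ideal.span (Set.range g)

/-!
Write `m = #K - 1` and let `t₀, …, tₙ` be the variables, so that `s = n + 1`.

The argument rests on one fact about the torus `(Kˣ)^V`: monomials whose exponents are incongruent
modulo `m` induce distinct characters, so a vanishing sum of monomial functions already vanishes
class by class (`sum_filter_modEq_eq_zero`).

Applied to the projective torus itself, this shows that its vanishing ideal is generated by the
binomials `tₖ ^ m - tₙ ^ m` (`projVanishingIdeal_projectiveTorus`), and a set of points over a finite
field is recovered from its vanishing ideal (`mem_of_forall_eval_eq_zero`). So the toric set `X` is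
the torus if and only if `I(X)` is generated by these `n` binomials, which are `s - 1` forms.

Applied to the parameterization of `X`, it shows that a form of degree `d < m` in `I(X)` has no
pure power term `tᵢ ^ d`, because no edge of the clutter contains another
(`coeff_single_eq_zero_of_mem`). Hence the elements of `I(X)` of degree less than `m` contribute
nothing to the pure power terms of degree `m`. The `n` binomials lie in `I(X)` and have linearly
independent pure power parts. So among any `n` forms which generate `I(X)`, all have to be of
degree `m`; comparing dimensions in degree `m`, they span the same space as the binomials
(`eq_span_binomials_of_eq_span_range`).
-/

/-! ### Monomial functions on the torus over a finite field -/

/-- If a sum of monomial functions vanishes on the whole torus `(Kˣ)^V`, then the coefficients of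
the monomials inducing any one given function on the torus add up to zero. (Two monomials induce the
same function exactly if their exponents are congruent modulo `#K - 1`.) -/
theorem sum_filter_modEq_eq_zero {K : Type*} [Field K] [Fintype K] {V : Type*} [Fintype V]
    {ι : Type*} (T : Finset ι) (c : ι → K) (E : ι → V → ℕ)
    (h : ∀ x : V → Kˣ, ∑ b ∈ T, c b * ∏ j, (x j : K) ^ E b j = 0) (r : V → ℕ)
    [DecidablePred fun b => ∀ j, E b j ≡ r j [MOD Fintype.card K - 1]] :
    ∑ b ∈ T with ∀ j, E b j ≡ r j [MOD Fintype.card K - 1], c b = 0 := by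
  classical
  have hm : 0 < Fintype.card K - 1 := Nat.sub_pos_of_lt Fintype.one_lt_card
  set m := Fintype.card K - 1 with hmdef
  -- Average the relation against the character `x ↦ x ^ (-r)`, written with exponent `(m - 1) * r`.
  have key : ∀ b, ∑ x : V → Kˣ, (∏ j, (x j : K) ^ ((m - 1) * r j)) * (c b * ∏ j, (x j : K) ^ E b j)
      = if ∀ j, E b j ≡ r j [MOD m] then c b * (-1) ^ Fintype.card V else 0 := by
    intro b
    have h1 : ∀ j, (m ∣ (m - 1) * r j + E b j) ↔ E b j ≡ r j [MOD m] := by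
      intro j
      obtain ⟨k, hk⟩ : ∃ k, m = k + 1 := ⟨m - 1, by omega⟩
      have h2 : (m - 1) * r j + r j = m * r j := by rw [hk]; simp; ring
      rw [← Nat.modEq_zero_iff_dvd]
      constructor
      · intro h3
        refine Nat.ModEq.add_left_cancel' ((m - 1) * r j) (h3.trans ?_)
        rw [h2]
        exact (Nat.modEq_zero_iff_dvd.2 (dvd_mul_right _ _)).symm
      · intro h3
        refine (h3.add_left ((m - 1) * r j)).trans ?_
        rw [h2]
        exact Nat.modEq_zero_iff_dvd.2 (dvd_mul_right _ _)
    have h4 : ∑ x : V → Kˣ,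
        (∏ j, (x j : K) ^ ((m - 1) * r j)) * (c b * ∏ j, (x j : K) ^ E b j)
        = c b * ∏ j, ∑ u : Kˣ, (u : K) ^ ((m - 1) * r j + E b j) := by
      rw [Fintype.prod_sum, Finset.mul_sum]
      refine Finset.sum_congr rfl fun x _ => ?_
      simp only [pow_add, Finset.prod_mul_distrib]
      ring
    rw [h4]
    simp only [FiniteField.sum_pow_units, ← hmdef, h1]
    split_ifs with h5
    · simp [h5]
    · push Not at h5
      obtain ⟨j, hj⟩ := h5
      rw [Finset.prod_eq_zero (Finset.mem_univ j) (if_neg hj), mul_zero]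
  have h6 : ∑ x : V → Kˣ, (∏ j, (x j : K) ^ ((m - 1) * r j)) *
      ∑ b ∈ T, c b * ∏ j, (x j : K) ^ E b j = 0 := by simp [h]
  simp only [Finset.mul_sum] at h6
  rw [Finset.sum_comm] at h6
  simp only [key] at h6
  rw [← Finset.sum_filter, ← Finset.sum_mul] at h6
  convert (mul_eq_zero.1 h6).resolve_right (pow_ne_zero _ (by simp))

/-! ### Vanishing ideals of sets of projective points -/

theorem eval_eq_zero_of_mem_projVanishingIdeal {K : Type*} [Field K] {s : ℕ}
    {X : Set (ℙ K (Fin s → K))} {f : MvPolynomial (Fin s) K} (hf : f ∈ projVanishingIdeal X)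
    {w : Fin s → K} (hw : w ≠ 0) (hX : Projectivization.mk K w hw ∈ X) :
    MvPolynomial.eval w f = 0 := by
  have : projVanishingIdeal X ≤ RingHom.ker (MvPolynomial.eval w) :=
    Ideal.span_le.2 fun g hg => hg.2 w hw hX
  exact this hf

theorem mem_projVanishingIdeal {K : Type*} [Field K] {s : ℕ}
    {X : Set (ℙ K (Fin s → K))} {f : MvPolynomial (Fin s) K} {d : ℕ} (hd : f.IsHomogeneous d)
    (hf : ∀ (w : Fin s → K) (hw : w ≠ 0), Projectivization.mk K w hw ∈ X →
      MvPolynomial.eval w f = 0) : f ∈ projVanishingIdeal X :=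
  Ideal.subset_span ⟨⟨d, hd⟩, hf⟩

theorem projVanishingIdeal_antitone {K : Type*} [Field K] {s : ℕ} {X Y : Set (ℙ K (Fin s → K))}
    (h : X ⊆ Y) : projVanishingIdeal Y ≤ projVanishingIdeal X :=
  Ideal.span_mono fun _ hf => ⟨hf.1, fun w hw hX => hf.2 w hw (h hX)⟩

theorem algebraicToricSet_subset_projectiveTorus (K : Type*) [Field K] {V : Type*} [Fintype V]
    {s : ℕ} (v : Fin s → V → ℕ) : algebraicToricSet K v ⊆ projectiveTorus K s := by
  rintro P ⟨x, hx, hw, rfl⟩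
  exact ⟨_, fun i => Finset.prod_ne_zero_iff.2 fun j _ => pow_ne_zero _ (hx j), hw, rfl⟩

theorem ne_zero_of_mk_mem_projectiveTorus {K : Type*} [Field K] {s : ℕ} {w : Fin s → K}
    (hw : w ≠ 0) (h : Projectivization.mk K w hw ∈ projectiveTorus K s) (i : Fin s) : w i ≠ 0 := by
  obtain ⟨x, hx, hx0, he⟩ := h
  obtain ⟨a, ha⟩ := (Projectivization.mk_eq_mk_iff' K w x hw hx0).1 he
  rintro hi
  have ha0 : a ≠ 0 := by rintro rfl; exact hw (by rw [← ha, zero_smul])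
  rw [← ha] at hi
  simp [ha0, hx i] at hi

open MvPolynomial in
/-- A set of points of a projective space over a finite field is the zero locus of its vanishing
ideal. -/
theorem mem_of_forall_eval_eq_zero {K : Type*} [Field K] [Fintype K] {s : ℕ}
    {X : Set (ℙ K (Fin s → K))} {w : Fin s → K} (hw : w ≠ 0)
    (h : ∀ f ∈ projVanishingIdeal X, eval w f = 0) : Projectivization.mk K w hw ∈ X := by
  classical
  by_contra hX
  -- Through each point of `X` there is a hyperplane which misses `w`.
  have h1 : ∀ Q : ℙ K (Fin s → K), ∃ l : MvPolynomial (Fin s) K, l.IsHomogeneous 1 ∧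
      (∀ a : K, eval (a • Q.rep) l = 0) ∧ (Q ∈ X → eval w l ≠ 0) := by
    intro Q
    by_cases hQ : Q ∈ X
    · by_contra! hcon
      have h2 : ∀ i j, Q.rep j * w i = Q.rep i * w j := by
        intro i j
        have := (hcon (C (Q.rep j) * MvPolynomial.X i - C (Q.rep i) * MvPolynomial.X j)
          ((isHomogeneous_C_mul_X _ _).sub (isHomogeneous_C_mul_X _ _))
          fun a => by simp; ring).2
        simpa [sub_eq_zero] using this
      obtain ⟨j, hj⟩ := Function.ne_iff.1 Q.rep_nonzero
      have hj : Q.rep j ≠ 0 := hj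
      apply hX
      have h3 : Projectivization.mk K w hw = Projectivization.mk K Q.rep Q.rep_nonzero := by
        refine (Projectivization.mk_eq_mk_iff' K _ _ _ _).2 ⟨w j / Q.rep j, ?_⟩
        ext i
        have := h2 i j
        simp only [Pi.smul_apply, smul_eq_mul]
        field_simp
        rw [mul_comm, ← this, mul_comm]
      rw [h3, Projectivization.mk_rep]
      exact hQ
    · exact ⟨0, isHomogeneous_zero _ _ _, by simp, fun h => absurd h hQ⟩
  choose l hl1 hl2 hl3 using h1
  have : Fintype (ℙ K (Fin s → K)) := Fintype.ofFinite _
  have h4 := h (∏ Q ∈ X.toFinset, l Q) (mem_projVanishingIdeal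
    (IsHomogeneous.prod X.toFinset l (fun _ => 1) fun Q _ => hl1 Q) fun v hv hvX => by
      rw [map_prod]
      refine Finset.prod_eq_zero (Set.mem_toFinset.2 hvX) ?_
      obtain ⟨a, ha⟩ := Projectivization.exists_smul_eq_mk_rep K v hv
      have h5 : v = (↑a⁻¹ : K) • (Projectivization.mk K v hv).rep := by
        rw [← ha, ← Units.smul_def, inv_smul_smul]
      have h6 := hl2 (Projectivization.mk K v hv) ↑a⁻¹
      rwa [← h5] at h6)
  rw [map_prod] at h4
  obtain ⟨Q, hQ, hQ0⟩ := Finset.prod_eq_zero_iff.1 h4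
  exact hl3 Q (Set.mem_toFinset.1 hQ) hQ0

/-! ### The vanishing ideal of the projective torus -/

open MvPolynomial in
/-- Modulo the binomials `tₖ ^ m - tₙ ^ m`, `m = #K - 1`, a monomial of given degree only depends on
its exponents modulo `m`, that is, on the function on the torus which it induces. So a form vanishing
on the torus is zero modulo the binomials, by `sum_filter_modEq_eq_zero`. -/
theorem projVanishingIdeal_projectiveTorus {K : Type*} [Field K] [Fintype K] (n : ℕ) :
    projVanishingIdeal (projectiveTorus K (n + 1)) = Ideal.span (Set.range fun k : Fin n =>
      (X k.castSucc ^ (Fintype.card K - 1) - X (Fin.last n) ^ (Fintype.card K - 1) :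
        MvPolynomial (Fin (n + 1)) K)) := by
  classical
  apply le_antisymm
  · refine Ideal.span_le.2 ?_
    rintro f ⟨⟨d, hd⟩, hf⟩
    set m := Fintype.card K - 1 with hmdef
    set J := Ideal.span (Set.range fun k : Fin n =>
      (X k.castSucc ^ m - X (Fin.last n) ^ m : MvPolynomial (Fin (n + 1)) K))
    let T : Fin (n + 1) → MvPolynomial (Fin (n + 1)) K ⧸ J := fun i => Ideal.Quotient.mk J (X i)
    have hT : ∀ i, T i ^ m = T (Fin.last n) ^ m := by
      intro i
      rcases Fin.eq_castSucc_or_eq_last i with ⟨k, rfl⟩ | rfl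
      · simp only [T, ← map_pow]
        exact Ideal.Quotient.eq.2 (Ideal.subset_span ⟨k, rfl⟩)
      · rfl
    let ρ : (Fin (n + 1) →₀ ℕ) → (Fin (n + 1) → ℕ) := fun b i => b i % m
    -- `F r` is the value of a monomial of degree `d` with exponents `≡ r`: the surplus powers of
    -- `Xᵢ ^ m` have been moved to the last variable, and the degree determines their number.
    let F : (Fin (n + 1) → ℕ) → MvPolynomial (Fin (n + 1)) K ⧸ J := fun r =>
      (∏ i, T i ^ r i) * T (Fin.last n) ^ (d - ∑ i, r i)
    have hF : ∀ b ∈ f.support, ∏ i, T i ^ b i = F (ρ b) := by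
      intro b hb
      have hdeg : ∑ i, b i = d := by
        rw [← Finsupp.degree_eq_sum]
        by_contra hne
        exact (mem_support_iff.1 hb) (hd.coeff_eq_zero hne)
      have h1 : ∀ i, T i ^ b i = T i ^ (b i % m) * T (Fin.last n) ^ (m * (b i / m)) := by
        intro i
        rw [pow_mul, ← hT i, ← pow_mul, ← pow_add, Nat.mod_add_div]
      have h2 : ∑ i, (b i % m) + ∑ i, m * (b i / m) = d := by
        rw [← Finset.sum_add_distrib, ← hdeg]
        exact Finset.sum_congr rfl fun i _ => Nat.mod_add_div _ _
      simp only [F, ρ]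
      rw [Finset.prod_congr rfl fun i _ => h1 i, Finset.prod_mul_distrib, Finset.prod_pow_eq_pow_sum,
        ← h2, Nat.add_sub_cancel_left]
    have hsum : ∀ a, ∑ b ∈ f.support with ρ b = ρ a, coeff b f = 0 := by
      intro a
      have := sum_filter_modEq_eq_zero f.support (fun b => coeff b f) (fun b i => b i)
        (fun x => by
          have hx0 : (fun i => (x i : K)) ≠ 0 := fun h0 => (x 0).ne_zero (congrFun h0 0)
          have := hf (fun i => (x i : K)) hx0 ⟨_, fun i => (x i).ne_zero, hx0, rfl⟩
          rwa [eval_eq'] at this) a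
      convert this using 3 with b
      simp [ρ, funext_iff, Nat.ModEq, hmdef]
    have hmk : Ideal.Quotient.mk J f =
        ∑ b ∈ f.support, algebraMap K _ (coeff b f) * ∏ i, T i ^ b i := by
      conv_lhs => rw [f.as_sum]
      rw [map_sum]
      refine Finset.sum_congr rfl fun b _ => ?_
      rw [monomial_eq, map_mul, Finsupp.prod_fintype _ _ (by simp), map_prod]
      simp only [T, map_pow]
      rfl
    refine Ideal.Quotient.eq_zero_iff_mem.1 ?_
    rw [hmk, Finset.sum_congr rfl fun b hb => by rw [hF b hb]]
    rw [← Finset.sum_fiberwise_of_maps_to (t := f.support.image ρ) (g := ρ)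
      fun b hb => Finset.mem_image_of_mem _ hb]
    refine Finset.sum_eq_zero fun r hr => ?_
    obtain ⟨a, -, rfl⟩ := Finset.mem_image.1 hr
    rw [Finset.sum_congr rfl fun b hb => by rw [(Finset.mem_filter.1 hb).2], ← Finset.sum_mul,
      ← map_sum, hsum a, map_zero, zero_mul]
  · refine Ideal.span_le.2 ?_
    rintro _ ⟨k, rfl⟩
    refine mem_projVanishingIdeal ((isHomogeneous_X_pow _ _).sub (isHomogeneous_X_pow _ _)) ?_
    intro w hw hX
    have h0 := ne_zero_of_mk_mem_projectiveTorus hw hX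
    simp [FiniteField.pow_card_sub_one_eq_one _ (h0 _)]

/-! ### Forms of small degree vanishing on the toric set of a clutter -/

open MvPolynomial in
/-- A form of degree `d < #K - 1` in the vanishing ideal of a toric set parameterized by the edges of
a clutter has no term `t_i ^ d`. Indeed, if `t^b` induces the same function as `t_i ^ d`, then for
each vertex `j` of the edge `f_i`, the number `∑_{k : j ∈ f_k} b_k ≤ d` is congruent to `d`, hence
equal to `d`; so every edge `f_k` with `b_k ≠ 0` contains `f_i` and therefore is `f_i`. -/
theorem coeff_single_eq_zero_of_mem {K : Type*} [Field K] [Fintype K] {V : Type*} [Fintype V]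
    [DecidableEq V] {s : ℕ} (e : Fin s → Finset V) (he : ∀ i k, e i ⊆ e k → i = k)
    {f : MvPolynomial (Fin s) K} {d : ℕ} (hd : f.IsHomogeneous d) (hdm : d < Fintype.card K - 1)
    (hf : f ∈ projVanishingIdeal (algebraicToricSet K fun i => characteristicVector (e i)))
    (i : Fin s) : coeff (Finsupp.single i d) f = 0 := by
  classical
  have h1 := sum_filter_modEq_eq_zero f.support (fun b => coeff b f)
    (fun b (j : V) => ∑ k, characteristicVector (e k) j * b k)
    (fun x => by
      have hw : (fun k => ∏ j, (x j : K) ^ characteristicVector (e k) j) ≠ 0 := fun h0 =>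
        Finset.prod_ne_zero_iff.2 (fun j _ => pow_ne_zero _ (x j).ne_zero) (congrFun h0 i)
      have h2 := eval_eq_zero_of_mem_projVanishingIdeal hf hw
        ⟨fun j => x j, fun j => (x j).ne_zero, hw, rfl⟩
      rw [eval_eq'] at h2
      rw [← h2]
      refine Finset.sum_congr rfl fun b _ => ?_
      congr 1
      simp only [← Finset.prod_pow, ← pow_mul, ← Finset.prod_pow_eq_pow_sum]
      exact Finset.prod_comm)
    (fun j => characteristicVector (e i) j * d)
  by_contra hne
  rw [Finset.sum_eq_single_of_mem (Finsupp.single i d)] at h1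
  · exact hne h1
  · refine Finset.mem_filter.2 ⟨mem_support_iff.2 hne, fun j => ?_⟩
    rw [Finset.sum_eq_single i (fun k _ hk => by simp [Finsupp.single_eq_of_ne hk]) (by simp)]
    simp [Nat.ModEq.refl]
  · intro b hb hbne
    exfalso
    obtain ⟨hb, hmod⟩ := Finset.mem_filter.1 hb
    have hdeg : ∑ k, b k = d := by
      rw [← Finsupp.degree_eq_sum]
      by_contra h3
      exact (mem_support_iff.1 hb) (hd.coeff_eq_zero h3)
    have hsupp : ∀ k, k ≠ i → b k = 0 := by
      intro k hk
      by_contra hbk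
      obtain ⟨j, hji, hjk⟩ := Finset.not_subset.1 fun h => hk (he i k h).symm
      have h4 := hmod j
      have h5 : ∑ k, characteristicVector (e k) j * b k < ∑ k, b k := by
        refine Finset.sum_lt_sum (fun l _ => ?_) ⟨k, Finset.mem_univ _, ?_⟩
        · unfold characteristicVector
          split_ifs <;> simp
        · simpa [characteristicVector, hjk] using Nat.pos_of_ne_zero hbk
      rw [hdeg] at h5
      have h6 : characteristicVector (e i) j * d = d := by simp [characteristicVector, hji]
      rw [h6] at h4
      exact h5.ne (h4.eq_of_lt_of_lt (h5.trans hdm) hdm)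
    apply hbne
    ext k
    by_cases hk : k = i
    · subst hk
      rw [Finset.sum_eq_single k (fun l _ hl => hsupp l hl) (by simp)] at hdeg
      simp [hdeg]
    · rw [hsupp k hk, Finsupp.single_eq_of_ne hk]

/-! ### Ideals generated by as many forms as there are binomials -/

open MvPolynomial in
theorem homogeneousComponent_mul_of_isHomogeneous {R σ : Type*} [CommSemiring R] {m : ℕ}
    {g : MvPolynomial σ R} (hg : g.IsHomogeneous m) (h : MvPolynomial σ R) :
    homogeneousComponent m (h * g) = coeff 0 h • g := by
  let _ : GradedRing (homogeneousSubmodule σ R) := gradedAlgebra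
  have := DirectSum.coe_decompose_mul_of_right_mem (homogeneousSubmodule σ R) m (a := h) (b := g)
    (i := m) hg
  rw [if_pos le_rfl, Nat.sub_self] at this
  rw [← C_mul', ← homogeneousComponent_zero]
  exact (decomposition.decompose'_apply _ _).symm.trans
    (this.trans (congrArg (· * g) (decomposition.decompose'_apply _ _)))

open MvPolynomial in
/-- A product with a form `g` of degree `d ≠ m` has no term `X i ^ m`, provided that `g` has no pure
power term in case `d < m`. -/
theorem coeff_single_mul_eq_zero {R σ : Type*} [CommSemiring R] {d m : ℕ} (hdm : d ≠ m)
    {g : MvPolynomial σ R} (hg : g.IsHomogeneous d) (i : σ)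
    (hlow : d < m → coeff (Finsupp.single i d) g = 0) (h : MvPolynomial σ R) :
    coeff (Finsupp.single i m) (h * g) = 0 := by
  classical
  rw [coeff_mul, Finsupp.antidiagonal_single, Finset.sum_map]
  refine Finset.sum_eq_zero fun p hp => ?_
  have hp' : p.1 + p.2 = m := by simpa using hp
  refine mul_eq_zero_of_right _ ?_
  change coeff (Finsupp.single i p.2) g = 0
  by_cases h2 : p.2 = d
  · rw [h2]; exact hlow (by omega)
  · exact hg.coeff_eq_zero (by simpa using h2)

open MvPolynomial in
/-- An ideal of `K[t₀, …, tₙ]` all of whose forms of degree `< m` lack pure power terms, and which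
contains the `n` binomials `tₖ ^ m - tₙ ^ m`, needs at least `n` generators of degree `m`, since
these binomials have linearly independent pure parts. So if `n` forms generate it, then all of them
have degree `m`, and they span the same space of forms as the binomials. -/
theorem eq_span_binomials_of_eq_span_range {K : Type*} [Field K] {n m : ℕ} (hm : 0 < m)
    {I : Ideal (MvPolynomial (Fin (n + 1)) K)}
    (hlow : ∀ f ∈ I, ∀ d < m, f.IsHomogeneous d → ∀ i, coeff (Finsupp.single i d) f = 0)
    (hB : ∀ k : Fin n, (X k.castSucc ^ m - X (Fin.last n) ^ m : MvPolynomial (Fin (n + 1)) K) ∈ I)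
    (g : Fin n → MvPolynomial (Fin (n + 1)) K) (hg : ∀ k, ∃ d, (g k).IsHomogeneous d)
    (hI : I = Ideal.span (Set.range g)) :
    I = Ideal.span (Set.range fun k : Fin n =>
      (X k.castSucc ^ m - X (Fin.last n) ^ m : MvPolynomial (Fin (n + 1)) K)) := by
  classical
  set B : Fin n → MvPolynomial (Fin (n + 1)) K := fun k => X k.castSucc ^ m - X (Fin.last n) ^ m
    with hBdef
  choose d hd using hg
  have hgI : ∀ k, g k ∈ I := fun k => hI ▸ Ideal.subset_span ⟨k, rfl⟩
  have hBhom : ∀ k, (B k).IsHomogeneous m := fun k =>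
    (isHomogeneous_X_pow _ _).sub (isHomogeneous_X_pow _ _)
  let φ : MvPolynomial (Fin (n + 1)) K →ₗ[K] (Fin n → K) :=
    LinearMap.pi fun k => lcoeff K (Finsupp.single k.castSucc m)
  have hφ : ∀ f k, φ f k = coeff (Finsupp.single k.castSucc m) f := fun f k => rfl
  have hφB : ∀ k, φ (B k) = Pi.single k 1 := by
    intro k
    ext j
    rw [hφ, hBdef]
    simp only [coeff_sub, X_pow_eq_monomial, coeff_monomial]
    simp [Finsupp.single_left_inj hm.ne', Pi.single_apply, (Fin.castSucc_lt_last j).ne', eq_comm]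
  have hφI : ∀ f ∈ I, φ f ∈ Submodule.span K (Set.range fun k : {k // d k = m} => φ (g k)) := by
    intro f hf
    rw [hI] at hf
    obtain ⟨c, rfl⟩ := Ideal.mem_span_range_iff_exists_fun.1 hf
    rw [map_sum]
    refine Submodule.sum_mem _ fun k _ => ?_
    by_cases hk : d k = m
    · have h1 : φ (c k * g k) = coeff 0 (c k) • φ (g k) := by
        ext j
        have h2 := congrArg (coeff (Finsupp.single j.castSucc m))
          (homogeneousComponent_mul_of_isHomogeneous (hk ▸ hd k) (c k))
        rw [coeff_homogeneousComponent, if_pos (by simp)] at h2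
        simpa [hφ] using h2
      rw [h1]
      exact Submodule.smul_mem _ _ (Submodule.subset_span ⟨⟨k, hk⟩, rfl⟩)
    · have h1 : φ (c k * g k) = 0 := by
        ext j
        exact coeff_single_mul_eq_zero hk (hd k) _ (fun h => hlow _ (hgI k) _ h (hd k) _) _
      rw [h1]
      exact Submodule.zero_mem _
  have hdm : ∀ k, d k = m := by
    by_contra! hne
    obtain ⟨k, hk⟩ := hne
    have htop : Submodule.span K (Set.range fun k : {k // d k = m} => φ (g k)) = ⊤ := by
      rw [eq_top_iff, ← (Pi.basisFun K (Fin n)).span_eq, Submodule.span_le]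
      rintro _ ⟨j, rfl⟩
      rw [Pi.basisFun_apply, ← hφB]
      exact hφI _ (hB j)
    have h1 := finrank_range_le_card (R := K) fun k : {k // d k = m} => φ (g k)
    rw [Set.finrank, htop, finrank_top, Module.finrank_fin_fun] at h1
    have h2 := Fintype.card_subtype_lt (p := fun k => d k = m) hk
    rw [Fintype.card_fin] at h2
    omega
  have hBlin : LinearIndependent K B := by
    refine LinearIndependent.of_comp φ ?_
    rw [show φ ∘ B = Pi.basisFun K (Fin n) from funext fun k => by simp [hφB]]
    exact (Pi.basisFun K (Fin n)).linearIndependent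
  have hle : Submodule.span K (Set.range B) ≤ Submodule.span K (Set.range g) := by
    rw [Submodule.span_le]
    rintro _ ⟨k, rfl⟩
    have h1 : B k ∈ I := hB k
    rw [hI] at h1
    obtain ⟨c, hc⟩ := Ideal.mem_span_range_iff_exists_fun.1 h1
    have h2 : homogeneousComponent m (B k) = B k := by
      rw [homogeneousComponent_of_mem (hBhom k), if_pos rfl]
    rw [← h2, ← hc, map_sum]
    refine Submodule.sum_mem _ fun j _ => ?_
    rw [homogeneousComponent_mul_of_isHomogeneous (hdm j ▸ hd j)]
    exact Submodule.smul_mem _ _ (Submodule.subset_span ⟨j, rfl⟩)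
  have : FiniteDimensional K (Submodule.span K (Set.range g)) :=
    FiniteDimensional.span_of_finite K (Set.finite_range g)
  have heq := Submodule.eq_of_le_of_finrank_le hle (by
    rw [finrank_span_eq_card hBlin]; exact finrank_range_le_card g)
  apply le_antisymm
  · rw [hI, Ideal.span_le]
    rintro _ ⟨k, rfl⟩
    have h1 : g k ∈ Submodule.span K (Set.range B) :=
      heq ▸ Submodule.subset_span ⟨k, rfl⟩
    exact Submodule.span_le_restrictScalars K (MvPolynomial (Fin (n + 1)) K) _ h1
  · rw [Ideal.span_le]
    rintro _ ⟨k, rfl⟩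
    exact hB k

/-! ### The equivalence -/

open MvPolynomial in
theorem setOf_binomials_eq_range {K : Type*} [Field K] {n m : ℕ} (hs : n + 1 - 1 < n + 1) :
    {f | ∃ i : Fin (n + 1), (i : ℕ) < n + 1 - 1 ∧
      f = (X i : MvPolynomial (Fin (n + 1)) K) ^ m - X ⟨n + 1 - 1, hs⟩ ^ m} =
    Set.range fun k : Fin n =>
      (X k.castSucc ^ m - X (Fin.last n) ^ m : MvPolynomial (Fin (n + 1)) K) := by
  ext f
  constructor
  · rintro ⟨i, hi, rfl⟩
    exact ⟨⟨i, hi⟩, rfl⟩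
  · rintro ⟨k, rfl⟩
    exact ⟨k.castSucc, k.2, rfl⟩

theorem corollary4p4 {K : Type*} [Field K] [Fintype K] (q : ℕ) (hq : Fintype.card K = q)
    {V : Type*} [Fintype V] [DecidableEq V] (C : Clutter V)
    (s : ℕ) (hs : 1 ≤ s) (e : Fin s ≃ {f : Finset V // f ∈ C.edges})
    (X : Set (ℙ K (Fin s → K)))
    (hX : X = algebraicToricSet K (fun i => characteristicVector (e i).1)) :
    [ IsCompleteIntersection (projVanishingIdeal X),
      projVanishingIdeal X =
        Ideal.span {f | ∃ i : Fin s, (i : ℕ) < s - 1 ∧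
          f = (MvPolynomial.X i : MvPolynomial (Fin s) K) ^ (q - 1)
            - MvPolynomial.X ⟨s - 1, Nat.sub_lt hs Nat.one_pos⟩ ^ (q - 1)},
      X = projectiveTorus K s ].TFAE := by
  obtain ⟨n, rfl⟩ : ∃ n, s = n + 1 := ⟨s - 1, by omega⟩
  subst hq
  rw [setOf_binomials_eq_range]
  have hm : 0 < Fintype.card K - 1 := Nat.sub_pos_of_lt Fintype.one_lt_card
  have hXT : X ⊆ projectiveTorus K (n + 1) := hX ▸ algebraicToricSet_subset_projectiveTorus K _
  have he : ∀ i k, (e i).1 ⊆ (e k).1 → i = k := fun i k h =>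
    e.injective (Subtype.ext (C.antichain.eq (e i).2 (e k).2 h))
  have hB : ∀ k : Fin n, (MvPolynomial.X k.castSucc ^ (Fintype.card K - 1) -
      MvPolynomial.X (Fin.last n) ^ (Fintype.card K - 1) : MvPolynomial (Fin (n + 1)) K) ∈
      projVanishingIdeal X := fun k =>
    projVanishingIdeal_antitone hXT
      (projVanishingIdeal_projectiveTorus (K := K) n ▸ Ideal.subset_span ⟨k, rfl⟩)
  tfae_have 1 → 2 := by
    rintro ⟨g, hg, hI⟩
    refine eq_span_binomials_of_eq_span_range hm ?_ hB g hg hI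
    intro f hf d hdm hd i
    exact coeff_single_eq_zero_of_mem (fun i => (e i).1) he hd hdm (hX ▸ hf) i
  tfae_have 2 → 1 := fun h => ⟨_, fun k => ⟨_, (MvPolynomial.isHomogeneous_X_pow _ _).sub
    (MvPolynomial.isHomogeneous_X_pow _ _)⟩, h⟩
  tfae_have 2 → 3 := by
    intro h
    refine hXT.antisymm ?_
    rintro _ ⟨x, hx, hx0, rfl⟩
    refine mem_of_forall_eval_eq_zero hx0 fun f hf => ?_
    rw [h, ← projVanishingIdeal_projectiveTorus] at hf
    exact eval_eq_zero_of_mem_projVanishingIdeal hf hx0 ⟨x, hx, hx0, rfl⟩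
  tfae_have 3 → 2 := fun h => by rw [h, projVanishingIdeal_projectiveTorus]
  tfae_finish
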